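/- Let $M$ be a smooth compact (Hausdorff) manifold without boundary, of dimension $d\ge 1$, and fix $t>0$. For a $C^2$ Riemannian metric $g$ on $M$ and $p\in C(M)$ with $p>0$, let $d_g$ be the geodesic distance of $g$ (the infimum of the lengths of $C^1$ paths, equal to $\infty$ between different components of $M$), let $\mu_g$ be the Riemannian volume measure of $g$, and define $$(L^{(g)}_{t,p}f)(x)=\frac{1}{t^{d/2+1}}\int_M \exp\Big(-\frac{d_g(x,y)^2}{t}\Big)\,\bigl(f(x)-f(y)\bigr)\,p(y)\,d\mu_g(y),\qquad f\in C(M),\ x\in M,$$ where $e^{-\infty}=0$. Let $g_1,g_2$ be $C^2$ Riemannian metrics on $M$ and let $p_1,p_2\in C(M)$ satisfy $p_1>0$ and $p_2>0$ on $M$. If $L^{(g_1)}_{t,p_1}=L^{(g_2)}_{t,p_2}$ as operators on $C(M)$, then $g_1=g_2$ and $p_1=p_2$. -/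

import Mathlib

open scoped Manifold ContDiff ENNReal Bundle
open MeasureTheory

noncomputable section

namespace GraphLaplacian

/-- The `C^2` Riemannian metrics on the (boundaryless) `d`-dimensional manifold `M`. -/
abbrev C2Metric (d : ℕ) (M : Type*) [TopologicalSpace M]
    [ChartedSpace (EuclideanSpace ℝ (Fin d)) M] [IsManifold (𝓡 d) ∞ M] :=
  Bundle.ContMDiffRiemannianMetric (𝓡 d) 2 (EuclideanSpace ℝ (Fin d))
    (fun x : M => TangentSpace (𝓡 d) x)

section Distance

variable {d : ℕ} {M : Type*} [TopologicalSpace M]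
  [ChartedSpace (EuclideanSpace ℝ (Fin d)) M] [IsManifold (𝓡 d) ∞ M]

/-- The geodesic distance `d_g(x, y)`: the infimum of the `g`-lengths of `C^1` paths from `x`
to `y`. It is `∞` exactly when `x` and `y` lie in different components of `M`. -/
def geodesicEDist (g : C2Metric d M) (x y : M) : ℝ≥0∞ :=
  letI : Bundle.RiemannianBundle (fun x : M => TangentSpace (𝓡 d) x) := ⟨g.toRiemannianMetric⟩
  Manifold.riemannianEDist (𝓡 d) x y

/-- The Gaussian kernel `exp (-d_g(x, y)^2 / t)`, with `exp (-∞) = 0`. -/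
def gaussianKernel (g : C2Metric d M) (t : ℝ) (x y : M) : ℝ :=
  if geodesicEDist g x y = ⊤ then 0
  else Real.exp (-(geodesicEDist g x y).toReal ^ 2 / t)

end Distance

section Volume

variable {d : ℕ} {M : Type*} [TopologicalSpace M]
  [ChartedSpace (EuclideanSpace ℝ (Fin d)) M] [IsManifold (𝓡 d) ∞ M]

/-- The coordinate vector `∂/∂u^i` of the preferred chart `φ` at `x`, at the point `φ⁻¹ u`. -/
def coordVector (x : M) (u : EuclideanSpace ℝ (Fin d)) (i : Fin d) :
    TangentSpace (𝓡 d) ((chartAt (EuclideanSpace ℝ (Fin d)) x).symm u) :=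
  mfderiv (𝓡 d) (𝓡 d) (chartAt (EuclideanSpace ℝ (Fin d)) x).symm u
    (EuclideanSpace.single i (1 : ℝ) : EuclideanSpace ℝ (Fin d))

/-- The matrix `g_ij(u) = g (∂/∂u^i, ∂/∂u^j)` of the metric in the preferred chart at `x`. -/
def gramMatrix (g : C2Metric d M) (x : M) (u : EuclideanSpace ℝ (Fin d)) :
    Matrix (Fin d) (Fin d) ℝ :=
  Matrix.of fun i j =>
    g.inner ((chartAt (EuclideanSpace ℝ (Fin d)) x).symm u) (coordVector x u i) (coordVector x u j)

/-- The Riemannian volume on the domain of the preferred chart `φ` at `x`: the image under `φ⁻¹`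
of `√(det g_ij(u)) du` on the target of `φ`. -/
def chartVolume [MeasurableSpace M] (g : C2Metric d M) (x : M) : Measure M :=
  (((volume : Measure (EuclideanSpace ℝ (Fin d))).restrict
      (chartAt (EuclideanSpace ℝ (Fin d)) x).target).withDensity
    (fun u => ENNReal.ofReal (Real.sqrt (gramMatrix g x u).det))).map
      (chartAt (EuclideanSpace ℝ (Fin d)) x).symm

theorem exists_chartPartition (d : ℕ) (M : Type*) [TopologicalSpace M]
    [ChartedSpace (EuclideanSpace ℝ (Fin d)) M] [T2Space M] [ParacompactSpace M] :
    ∃ ρ : PartitionOfUnity M M (Set.univ : Set M),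
      ρ.IsSubordinate fun x => (chartAt (EuclideanSpace ℝ (Fin d)) x).source :=
  PartitionOfUnity.exists_isSubordinate isClosed_univ _
    (fun x => (chartAt (EuclideanSpace ℝ (Fin d)) x).open_source)
    (fun x _ => Set.mem_iUnion.2 ⟨x, mem_chart_source _ x⟩)

/-- A partition of unity subordinate to the preferred charts of `M`. It is chosen once for `M` and
does not depend on a metric. -/
def chartPartition (d : ℕ) (M : Type*) [TopologicalSpace M]
    [ChartedSpace (EuclideanSpace ℝ (Fin d)) M] [T2Space M] [ParacompactSpace M] :
    PartitionOfUnity M M (Set.univ : Set M) :=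
  (exists_chartPartition d M).choose

/-- The Riemannian volume measure `μ_g`, glued from the volumes on the chart domains with a
partition of unity `ρ`: `∫ f dμ_g = ∑ₓ ∫ (ρₓ f)(φₓ⁻¹ u) √(det g_ij(u)) du`. -/
def riemannianVolume [T2Space M] [ParacompactSpace M] [MeasurableSpace M] (g : C2Metric d M) :
    Measure M :=
  Measure.sum fun x : M =>
    (chartVolume g x).withDensity fun y => ENNReal.ofReal (chartPartition d M x y)

end Volume

/-- The unnormalized continuous intrinsic graph Laplace operator
`(L f)(x) = t^{-(d/2+1)} ∫ exp (-d_g(x, y)^2 / t) (f(x) - f(y)) p(y) dμ_g(y)` for `f ∈ C(M)`. -/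
def intrinsicGraphLaplacian {d : ℕ} {M : Type*} [TopologicalSpace M]
    [ChartedSpace (EuclideanSpace ℝ (Fin d)) M] [IsManifold (𝓡 d) ∞ M]
    [T2Space M] [CompactSpace M] [MeasurableSpace M]
    (g : C2Metric d M) (t : ℝ) (p : C(M, ℝ)) (f : C(M, ℝ)) (x : M) : ℝ :=
  1 / t ^ ((d : ℝ) / 2 + 1) *
    ∫ y, gaussianKernel g t x y * (f x - f y) * p y ∂(riemannianVolume g)

end GraphLaplacian

end

/-!
A continuous `f` with `f x = 0` satisfies `L f (x) = -t^{-(d/2+1)} ∫ k(x, y) p(y) f(y) dμ_g(y)`,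
where `k` is the Gaussian kernel of `g`. So `L` determines the measure `k(x, ·) p μ_g` off the point `x`.

The volumes of two metrics are comparable: `μ_{g₁} = R μ_{g₂}` for a positive continuous function
`R` on `M`, the square root of a ratio of determinants of `g₁` and `g₂` in one and the same basis of
the tangent space (`riemannianVolume_eq_withDensity`). Equality of the two operators therefore says
that `F = k₁(x, ·) p₁ R - k₂(x, ·) p₂` is orthogonal in `L²(μ_{g₂})` to every continuous function
vanishing at `x`. Testing against `F (1 - k₁(x, ·))`, which vanishes at `x`, gives
`∫ F² (1 - k₁(x, ·)) dμ_{g₂} = 0`; as `k₁(x, y) < 1` for `y ≠ x` and `μ_{g₂}` charges every nonempty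
open set, `F` vanishes off `x`, and then also at `x`, because `x` is not isolated when `d ≥ 1`
(`gaussianKernel_mul_density_eq`).

On the diagonal the kernels equal `1`, so `p₁ R = p₂`; dividing by `p₂ > 0` gives `k₁ = k₂`, hence
`d_{g₁} = d_{g₂}`.

A metric is recovered from its distance: in the chart at `x`, the distance `d_g(x, y)` and the norm
of the coordinate difference for `g` at `x` agree up to a factor arbitrarily close to `1` as `y → x`
(`eventually_riemannianEDist_comparable`). Letting `y → x` along a line in the chart shows that
equal distances have equal norms on each tangent space, and polarization gives `g₁ = g₂`
(`C2Metric.eq_of_geodesicEDist_eq`). Then `R = 1` and `p₁ = p₂`.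
-/

namespace GraphLaplacian

open Set Filter Manifold
open scoped Topology NNReal

/-! ### The Riemannian distance near a point -/

section LocalDistance

variable {E : Type*} [NormedAddCommGroup E] [NormedSpace ℝ E]
  {H : Type*} [TopologicalSpace H] (I : ModelWithCorners ℝ E H)
  {M : Type*} [TopologicalSpace M] [ChartedSpace H M]
  [Bundle.RiemannianBundle (fun x : M => TangentSpace I x)]
  [IsManifold I 1 M] [IsContinuousRiemannianBundle E (fun x : M => TangentSpace I x)]

/-- If `A : E →L[ℝ] G` composed with the derivative of the chart at `x` is bounded by `r` near `x`,
then `A` composed with the chart is `r`-Lipschitz at `x` for the Riemannian distance. A path from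
`x` of length less than the radius of a small ball stays in that ball, so the bound on the
derivative can be integrated along almost minimizing paths. -/
theorem eventually_enorm_extChartAt_sub_le [RegularSpace M] (x : M) {G : Type*}
    [NormedAddCommGroup G] [NormedSpace ℝ G] (A : E →L[ℝ] G) {r : ℝ≥0} (hr : r ≠ 0)
    (h : ∀ᶠ y in 𝓝 x, ∀ v : TangentSpace I y,
      ‖A (mfderiv I 𝓘(ℝ, E) (extChartAt I x) y v)‖ₑ ≤ r * ‖v‖ₑ) :
    ∀ᶠ y in 𝓝 x, ‖A (extChartAt I x y - extChartAt I x x)‖ₑ ≤ r * riemannianEDist I x y := by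
  -- the ball of radius `c` lies in the chart domain and in the set where the bound holds
  obtain ⟨c, hc, hcs⟩ := setOfPred_riemannianEDist_lt_subset_nhds' I
    (inter_mem h (chart_source_mem_nhds H x))
  filter_upwards [eventually_riemannianEDist_lt I x hc] with y hy
  rw [mul_comm, ← ENNReal.div_le_iff_le_mul (Or.inl (by simpa using hr))
    (Or.inl ENNReal.coe_ne_top)]
  refine le_of_forall_gt fun r' hr' => ?_
  obtain ⟨γ, γ0, γ1, hγ, hlen⟩ := exists_lt_of_riemannianEDist_lt (lt_min hr' hy)
  have hmem : ∀ s ∈ Icc (0 : ℝ) 1, γ s ∈ {y : M | ∀ v : TangentSpace I y,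
      ‖A (mfderiv I 𝓘(ℝ, E) (extChartAt I x) y v)‖ₑ ≤ r * ‖v‖ₑ} ∩ (chartAt H x).source := by
    intro s hs
    apply hcs
    calc riemannianEDist I x (γ s) ≤ pathELength I γ 0 s :=
          riemannianEDist_le_pathELength (hγ.mono (Icc_subset_Icc_right hs.2)) γ0 rfl hs.1
      _ ≤ pathELength I γ 0 1 := pathELength_mono le_rfl hs.2
      _ < c := hlen.trans_le (min_le_right _ _)
  refine lt_of_le_of_lt ?_ (hlen.trans_le (min_le_left _ _))
  rw [ENNReal.div_le_iff_le_mul (Or.inl (by simpa using hr)) (Or.inl ENNReal.coe_ne_top), mul_comm]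
  have hσ : ContMDiffOn 𝓘(ℝ) 𝓘(ℝ, E) 1 (extChartAt I x ∘ γ) (Icc 0 1) :=
    contMDiffOn_extChartAt.comp (I' := I) (t := (chartAt H x).source) hγ fun s hs => (hmem s hs).2
  rw [contMDiffOn_iff_contDiffOn] at hσ
  have hAσ : ContDiffOn ℝ 1 (fun s => A (extChartAt I x (γ s))) (Icc 0 1) :=
    A.contDiff.comp_contDiffOn hσ
  calc ‖A (extChartAt I x y - extChartAt I x x)‖ₑ
      = ‖A (extChartAt I x (γ 1)) - A (extChartAt I x (γ 0))‖ₑ := by rw [γ0, γ1, map_sub]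
    _ ≤ ∫⁻ s in Icc (0 : ℝ) 1, ‖derivWithin (fun s => A (extChartAt I x (γ s))) (Icc 0 1) s‖ₑ :=
      enorm_sub_le_lintegral_derivWithin_Icc_of_contDiffOn_Icc hAσ zero_le_one
    _ ≤ ∫⁻ s in Icc (0 : ℝ) 1, r * ‖mfderivWithin 𝓘(ℝ) I γ (Icc 0 1) s 1‖ₑ := by
      refine setLIntegral_mono' measurableSet_Icc fun s hs => ?_
      have hu : UniqueDiffWithinAt ℝ (Icc (0 : ℝ) 1) s := uniqueDiffOn_Icc zero_lt_one s hs
      have h1 : mfderivWithin 𝓘(ℝ) 𝓘(ℝ, E) (extChartAt I x ∘ γ) (Icc 0 1) s =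
          (mfderiv I 𝓘(ℝ, E) (extChartAt I x) (γ s)) ∘L
            (mfderivWithin 𝓘(ℝ) I γ (Icc 0 1) s) := by
        apply mfderiv_comp_mfderivWithin
        · exact mdifferentiableAt_extChartAt (hmem s hs).2
        · exact hγ.mdifferentiableOn one_ne_zero s hs
        · rwa [uniqueMDiffWithinAt_iff_uniqueDiffWithinAt]
      have h2 : derivWithin (fun s => A (extChartAt I x (γ s))) (Icc 0 1) s =
          A (mfderiv I 𝓘(ℝ, E) (extChartAt I x) (γ s)
            (mfderivWithin 𝓘(ℝ) I γ (Icc 0 1) s 1)) := by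
        have h3 := (A.hasFDerivAt.comp_hasDerivWithinAt s
          ((hσ.differentiableOn one_ne_zero s hs).hasDerivWithinAt)).derivWithin hu
        refine h3.trans ?_
        congr 1
        rw [← fderivWithin_derivWithin, ← mfderivWithin_eq_fderivWithin]
        exact congr($h1 1)
      rw [h2]
      exact (hmem s hs).1 _
    _ = r * pathELength I γ 0 1 := by
      rw [lintegral_const_mul' _ _ ENNReal.coe_ne_top, pathELength_eq_lintegral_mfderivWithin_Icc]

omit [IsContinuousRiemannianBundle E fun x : M => TangentSpace I x] in
/-- If the derivative of the inverse chart at `x` is bounded by `r` near `x`, for the seminorm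
`‖A ·‖` on `E`, then `d(x, y) ≤ r ‖A (φ y - φ x)‖` near `x`: this is the length of the preimage of a
segment. -/
theorem eventually_riemannianEDist_le_enorm [I.Boundaryless] (x : M) {G : Type*}
    [NormedAddCommGroup G] [NormedSpace ℝ G] (A : E →L[ℝ] G) {r : ℝ≥0}
    (h : ∀ᶠ y in 𝓝 x, ∀ v : E,
      ‖mfderivWithin 𝓘(ℝ, E) I (extChartAt I x).symm (range I) (extChartAt I x y) v‖ₑ
        ≤ r * ‖A v‖ₑ) :
    ∀ᶠ y in 𝓝 x, riemannianEDist I x y ≤ r * ‖A (extChartAt I x y - extChartAt I x x)‖ₑ := by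
  have hE : ∀ᶠ z in 𝓝 (extChartAt I x x), z ∈ (extChartAt I x).target ∧ ∀ v : E,
      ‖mfderivWithin 𝓘(ℝ, E) I (extChartAt I x).symm (range I) z v‖ₑ ≤ r * ‖A v‖ₑ := by
    have h1 : Tendsto (extChartAt I x).symm (𝓝 (extChartAt I x x)) (𝓝 x) := by
      simpa [ContinuousAt] using continuousAt_extChartAt_symm (I := I) x
    filter_upwards [h1.eventually h, extChartAt_target_mem_nhds (I := I) x] with z hz hzt
    refine ⟨hzt, ?_⟩
    rwa [(extChartAt I x).right_inv hzt] at hz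
  obtain ⟨ε, hε, hball⟩ := Metric.eventually_nhds_iff_ball.1 hE
  filter_upwards [(continuousAt_extChartAt (I := I) x).preimage_mem_nhds
      (Metric.ball_mem_nhds _ hε),
    chart_source_mem_nhds H x] with y hy hys
  let η := ContinuousAffineMap.lineMap (R := ℝ) (extChartAt I x x) (extChartAt I x y)
  have hη : ∀ s ∈ Icc (0 : ℝ) 1, η s ∈ Metric.ball (extChartAt I x x) ε := by
    suffices hη : η '' Icc 0 1 ⊆ Metric.ball (extChartAt I x x) ε from
      fun s hs => hη (mem_image_of_mem _ hs)
    rw [ContinuousAffineMap.coe_lineMap_eq, ← segment_eq_image_lineMap]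
    exact (convex_ball _ _).segment_subset (Metric.mem_ball_self hε) hy
  have η_smooth : ContMDiffOn 𝓘(ℝ) 𝓘(ℝ, E) 1 η (Icc 0 1) :=
    (contMDiff_iff_contDiff.2 η.contDiff).contMDiffOn
  have hlen : riemannianEDist I x y ≤ pathELength I ((extChartAt I x).symm ∘ η) 0 1 := by
    apply riemannianEDist_le_pathELength _ _ _ zero_le_one
    · exact (contMDiffOn_extChartAt_symm x).comp η_smooth fun s hs => (hball _ (hη s hs)).1
    · simp [η, ContinuousAffineMap.coe_lineMap_eq]
    · simp [η, ContinuousAffineMap.coe_lineMap_eq, hys]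
  refine hlen.trans ?_
  rw [pathELength_eq_lintegral_mfderivWithin_Icc]
  calc ∫⁻ s in Icc (0 : ℝ) 1,
        ‖mfderivWithin 𝓘(ℝ) I ((extChartAt I x).symm ∘ η) (Icc 0 1) s 1‖ₑ
      ≤ ∫⁻ s in Icc (0 : ℝ) 1, r * ‖A (extChartAt I x y - extChartAt I x x)‖ₑ := by
        refine setLIntegral_mono' measurableSet_Icc fun s hs => ?_
        have hu : UniqueDiffWithinAt ℝ (Icc (0 : ℝ) 1) s := uniqueDiffOn_Icc zero_lt_one s hs
        have h1 : mfderivWithin 𝓘(ℝ) I ((extChartAt I x).symm ∘ η) (Icc 0 1) s =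
            (mfderivWithin 𝓘(ℝ, E) I (extChartAt I x).symm (range I) (η s)) ∘L
              (mfderivWithin 𝓘(ℝ) 𝓘(ℝ, E) η (Icc 0 1) s) := by
          apply mfderivWithin_comp
          · exact mdifferentiableWithinAt_extChartAt_symm (hball _ (hη s hs)).1
          · exact η_smooth.mdifferentiableOn one_ne_zero s hs
          · simp [I.range_eq_univ]
          · rwa [uniqueMDiffWithinAt_iff_uniqueDiffWithinAt]
        have h2 : mfderivWithin 𝓘(ℝ) 𝓘(ℝ, E) η (Icc 0 1) s (1 : ℝ) =
            (extChartAt I x y - extChartAt I x x : E) := by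
          rw [mfderivWithin_eq_fderivWithin]
          change fderivWithin ℝ η (Icc 0 1) s 1 = _
          rw [fderivWithin_eq_fderiv hu η.differentiableAt]
          simp [η]
        have h3 : mfderivWithin 𝓘(ℝ) I ((extChartAt I x).symm ∘ η) (Icc 0 1) s (1 : ℝ) =
            mfderivWithin 𝓘(ℝ, E) I (extChartAt I x).symm (range I) (η s)
              (extChartAt I x y - extChartAt I x x : E) :=
          congr($h1 (1 : ℝ)).trans
            (congrArg (mfderivWithin 𝓘(ℝ, E) I (extChartAt I x).symm (range I) (η s)) h2)
        refine (congrArg enorm h3).trans_le ((hball _ (hη s hs)).2 _)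
    _ = r * ‖A (extChartAt I x y - extChartAt I x x)‖ₑ := by simp

end LocalDistance

/-! ### Recovery of the metric from its distance -/

section Infinitesimal

variable {E : Type*} [NormedAddCommGroup E] [NormedSpace ℝ E]
  {H : Type*} [TopologicalSpace H] (I : ModelWithCorners ℝ E H) [I.Boundaryless]
  {M : Type*} [TopologicalSpace M] [ChartedSpace H M] [RegularSpace M]
  [Bundle.RiemannianBundle (fun x : M => TangentSpace I x)]
  [IsManifold I 1 M] [IsContinuousRiemannianBundle E (fun x : M => TangentSpace I x)]

/-- Near `x`, the distance to `x` agrees, up to a factor arbitrarily close to `1`, with the norm of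
the coordinate difference for the inner product at `x`. -/
theorem eventually_riemannianEDist_comparable (x : M) {r : ℝ≥0} (hr : 1 < r) :
    ∀ᶠ y in 𝓝 x,
      ‖(trivializationAt E (TangentSpace I) x).symmL ℝ x
        (extChartAt I x y - extChartAt I x x)‖ₑ ≤ r * riemannianEDist I x y ∧
      riemannianEDist I x y ≤ r * ‖(trivializationAt E (TangentSpace I) x).symmL ℝ x
        (extChartAt I x y - extChartAt I x x)‖ₑ := by
  have hop : ∀ {X Y : Type _} [NormedAddCommGroup X] [NormedSpace ℝ X] [NormedAddCommGroup Y]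
      [NormedSpace ℝ Y] (T : X →L[ℝ] Y), ‖T‖ < r → ∀ v, ‖T v‖ₑ ≤ r * ‖v‖ₑ := by
    intro X Y _ _ _ _ T hT v
    refine (T.le_opENorm v).trans ?_
    gcongr
    exact ENNReal.coe_le_coe.2 (show ‖T‖₊ ≤ r from hT.le)
  apply (eventually_enorm_extChartAt_sub_le I x _ (by positivity) ?_).and
    (eventually_riemannianEDist_le_enorm I x _ ?_)
  · filter_upwards [eventually_norm_symmL_trivializationAt_self_comp_lt E
      (fun x : M => TangentSpace I x) x (r := r) (by exact_mod_cast hr),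
      chart_source_mem_nhds H x] with y hy hys v
    rw [← TangentBundle.continuousLinearMapAt_trivializationAt hys]
    exact hop _ hy v
  · filter_upwards [eventually_norm_symmL_trivializationAt_comp_self_lt E
      (fun x : M => TangentSpace I x) x (r := r) (by exact_mod_cast hr),
      chart_source_mem_nhds H x] with y hy hys v
    have hxx : x ∈ (trivializationAt E (TangentSpace I) x).baseSet :=
      FiberBundle.mem_baseSet_trivializationAt' x
    -- `(extChartAt I x).symm (extChartAt I x y)` is only propositionally equal to `y`, so the
    -- norms of the two tangent spaces have to be identified by hand
    have hcast : ∀ z : M, z = y → ∀ w : E,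
        ‖(show TangentSpace I z from w)‖ₑ = ‖(show TangentSpace I y from w)‖ₑ := by
      rintro _ rfl _
      rfl
    have hD := congr($(TangentBundle.symmL_trivializationAt (I := I) (𝕜 := ℝ) hys) v)
    refine ((hcast _ ((extChartAt I x).left_inv (by simpa using hys)) _).trans
      (congrArg enorm hD).symm).trans_le ?_
    have h1 := hop _ hy ((trivializationAt E (TangentSpace I) x).symmL ℝ x v)
    rwa [ContinuousLinearMap.comp_apply,
      (trivializationAt E (TangentSpace I) x).continuousLinearMapAt_symmL hxx] at h1

end Infinitesimal

variable {d : ℕ} {M : Type*} [TopologicalSpace M]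
  [ChartedSpace (EuclideanSpace ℝ (Fin d)) M] [IsManifold (𝓡 d) ∞ M]

theorem C2Metric.isContinuousRiemannianBundle (g : C2Metric d M) :
    letI : Bundle.RiemannianBundle (fun x : M => TangentSpace (𝓡 d) x) := ⟨g.toRiemannianMetric⟩
    IsContinuousRiemannianBundle (EuclideanSpace ℝ (Fin d))
      (fun x : M => TangentSpace (𝓡 d) x) := by
  let : Bundle.RiemannianBundle (fun x : M => TangentSpace (𝓡 d) x) := ⟨g.toRiemannianMetric⟩
  exact ⟨⟨g.inner, g.contMDiff.continuous, fun _ _ _ => rfl⟩⟩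

/-- The norm of `v` for the inner product `g` at `x`, as an extended nonnegative real. -/
noncomputable def fiberENorm (g : C2Metric d M) (x : M) (v : TangentSpace (𝓡 d) x) : ℝ≥0∞ :=
  ENNReal.ofReal (Real.sqrt (g.inner x v v))

/-- `eventually_riemannianEDist_comparable` for the distance of a `C^2` metric `g`. -/
theorem eventually_geodesicEDist_comparable [RegularSpace M] (g : C2Metric d M) (x : M) {r : ℝ≥0}
    (hr : 1 < r) :
    ∀ᶠ y in 𝓝 x,
      fiberENorm g x ((trivializationAt (EuclideanSpace ℝ (Fin d)) (TangentSpace (𝓡 d)) x).symmL ℝ x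
        (extChartAt (𝓡 d) x y - extChartAt (𝓡 d) x x)) ≤ r * geodesicEDist g x y ∧
      geodesicEDist g x y ≤ r * fiberENorm g x
        ((trivializationAt (EuclideanSpace ℝ (Fin d)) (TangentSpace (𝓡 d)) x).symmL ℝ x
          (extChartAt (𝓡 d) x y - extChartAt (𝓡 d) x x)) := by
  let : Bundle.RiemannianBundle (fun x : M => TangentSpace (𝓡 d) x) := ⟨g.toRiemannianMetric⟩
  have := g.isContinuousRiemannianBundle
  have : IsManifold (𝓡 d) 1 M := IsManifold.of_le (n := ∞) (by norm_cast)
  have hn : ∀ v : TangentSpace (𝓡 d) x, ‖v‖ₑ = fiberENorm g x v := by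
    intro v
    rw [fiberENorm, ← ofReal_norm, norm_eq_sqrt_real_inner]
    rfl
  simpa only [hn, geodesicEDist] using eventually_riemannianEDist_comparable (𝓡 d) x hr

/-- Comparison of the two distances from `x` along the curve whose coordinates are `φ x + s v`, as
`s → 0`. -/
theorem inner_self_le_of_geodesicEDist_eq [RegularSpace M] {g₁ g₂ : C2Metric d M} {x : M}
    (h : ∀ y, geodesicEDist g₁ x y = geodesicEDist g₂ x y) (v : TangentSpace (𝓡 d) x) :
    g₁.inner x v v ≤ g₂.inner x v v := by
  set τ := trivializationAt (EuclideanSpace ℝ (Fin d)) (TangentSpace (𝓡 d)) x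
  have hτ : ∀ w, τ.symmL ℝ x (τ.continuousLinearMapAt ℝ x w) = w := fun w =>
    τ.symmL_continuousLinearMapAt ( FiberBundle.mem_baseSet_trivializationAt' x) w
  have hscale : ∀ (g : C2Metric d M) (s : ℝ), 0 ≤ s →
      fiberENorm g x (s • v) = ENNReal.ofReal s * fiberENorm g x v := by
    intro g s hs
    simp only [fiberENorm, map_smul, smul_apply, smul_eq_mul]
    rw [← mul_assoc, Real.sqrt_mul (by positivity), Real.sqrt_mul_self hs, ENNReal.ofReal_mul hs]
  -- one factor `r` comes from each of the two metrics
  have key : ∀ r : ℝ≥0, 1 < r → fiberENorm g₁ x v ≤ r * (r * fiberENorm g₂ x v) := by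
    intro r hr
    let e : EuclideanSpace ℝ (Fin d) := τ.continuousLinearMapAt ℝ x v
    let c : ℝ → EuclideanSpace ℝ (Fin d) := fun s => extChartAt (𝓡 d) x x + s • e
    have hc : Tendsto c (𝓝[>] 0) (𝓝 (extChartAt (𝓡 d) x x)) := by
      have : Continuous c := by fun_prop
      have h0 := this.tendsto 0
      simp only [c, zero_smul, add_zero] at h0
      exact h0.mono_left nhdsWithin_le_nhds
    have hγ : Tendsto (fun s => (extChartAt (𝓡 d) x).symm (c s)) (𝓝[>] 0) (𝓝 x) := by
      have h1 : Tendsto (extChartAt (𝓡 d) x).symm (𝓝 (extChartAt (𝓡 d) x x)) (𝓝 x) := by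
        simpa [ContinuousAt] using continuousAt_extChartAt_symm (I := 𝓡 d) x
      exact h1.comp hc
    obtain ⟨s, ⟨⟨h1, -⟩, -, h2⟩, hs, hst⟩ :=
      ((hγ.eventually ((eventually_geodesicEDist_comparable g₁ x hr).and
        (eventually_geodesicEDist_comparable g₂ x hr))).and
        (Filter.Eventually.and self_mem_nhdsWithin
          (hc.eventually (extChartAt_target_mem_nhds (I := 𝓡 d) x)))).exists
    have hs : 0 < s := hs
    have hcs : τ.symmL ℝ x (c s - extChartAt (𝓡 d) x x) = s • v := by
      simp only [c, add_sub_cancel_left, map_smul, e, hτ]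
    rw [(extChartAt (𝓡 d) x).right_inv hst, hcs, hscale _ _ hs.le] at h1 h2
    rw [h] at h1
    have h3 := h1.trans (mul_le_mul_right h2 _)
    have hs0 : ENNReal.ofReal s ≠ 0 := by simpa using hs
    rw [mul_left_comm (r : ℝ≥0∞) (.ofReal s), mul_left_comm (r : ℝ≥0∞) (.ofReal s)] at h3
    exact (ENNReal.mul_le_mul_iff_right hs0 ENNReal.ofReal_ne_top).1 h3
  have hle : fiberENorm g₁ x v ≤ fiberENorm g₂ x v := by
    have ht : Tendsto (fun r : ℝ≥0 => (r : ℝ≥0∞) * (r * fiberENorm g₂ x v)) (𝓝[>] 1)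
        (𝓝 ((1 : ℝ≥0) * ((1 : ℝ≥0) * fiberENorm g₂ x v))) := by
      have hr : Tendsto (fun r : ℝ≥0 => (r : ℝ≥0∞)) (𝓝[>] 1) (𝓝 ((1 : ℝ≥0) : ℝ≥0∞)) :=
        (ENNReal.continuous_coe.tendsto 1).mono_left nhdsWithin_le_nhds
      have h1 := ENNReal.Tendsto.mul_const hr (b := fiberENorm g₂ x v) (Or.inl (by simp))
      exact ENNReal.Tendsto.mul hr (Or.inl (by simp)) h1 (Or.inr (by simp))
    rw [ENNReal.coe_one, one_mul, one_mul] at ht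
    exact ge_of_tendsto ht (eventually_mem_nhdsWithin.mono fun r hr => key r hr)
  have hnn : 0 ≤ g₂.inner x v v := by
    by_cases hv : v = 0
    · simp [hv]
    · exact (g₂.pos x v hv).le
  rw [fiberENorm, fiberENorm, ENNReal.ofReal_le_ofReal_iff (Real.sqrt_nonneg _)] at hle
  exact (Real.sqrt_le_sqrt_iff hnn).1 hle

theorem C2Metric.eq_of_geodesicEDist_eq [RegularSpace M] {g₁ g₂ : C2Metric d M}
    (h : ∀ x y, geodesicEDist g₁ x y = geodesicEDist g₂ x y) : g₁ = g₂ := by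
  have hq : ∀ x (v : TangentSpace (𝓡 d) x), g₁.inner x v v = g₂.inner x v v := fun x v =>
    le_antisymm (inner_self_le_of_geodesicEDist_eq (h x) v)
      (inner_self_le_of_geodesicEDist_eq (fun y => (h x y).symm) v)
  have hi : g₁.inner = g₂.inner := by
    funext x
    ext v w
    have hvw := hq x (v + w)
    simp only [map_add, add_apply, hq x v, hq x w, g₁.symm x w v,
      g₂.symm x w v] at hvw
    linarith
  cases g₁; cases g₂; congr

/-! ### Gram determinants -/

/-- The inner product of `g` at `y` as a bilinear form on the model space, which by definition is
the tangent space at `y`. This gives Gram determinants that do not refer to a choice of chart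
around `y`. -/
noncomputable def modelForm (g : C2Metric d M) (y : M) :
    EuclideanSpace ℝ (Fin d) →ₗ[ℝ] EuclideanSpace ℝ (Fin d) →ₗ[ℝ] ℝ :=
  LinearMap.mk₂ ℝ (fun v w => g.inner y (show TangentSpace (𝓡 d) y from v)
      (show TangentSpace (𝓡 d) y from w))
    (fun v v' w => congr($((g.inner y).map_add (show TangentSpace (𝓡 d) y from v) v')
      (show TangentSpace (𝓡 d) y from w)))
    (fun c v w => congr($((g.inner y).map_smul c (show TangentSpace (𝓡 d) y from v))
      (show TangentSpace (𝓡 d) y from w)))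
    (fun v w w' => (g.inner y (show TangentSpace (𝓡 d) y from v)).map_add w w')
    (fun c v w => (g.inner y (show TangentSpace (𝓡 d) y from v)).map_smul c w)

/-- The matrix of `modelForm g y` in the standard basis of the model space. -/
noncomputable def modelGram (g : C2Metric d M) (y : M) : Matrix (Fin d) (Fin d) ℝ :=
  LinearMap.toMatrix₂ (EuclideanSpace.basisFun (Fin d) ℝ).toBasis
    (EuclideanSpace.basisFun (Fin d) ℝ).toBasis (modelForm g y)

theorem det_modelGram_pos (g : C2Metric d M) (y : M) : 0 < (modelGram g y).det := by
  refine Matrix.PosDef.det_pos (Matrix.PosDef.of_dotProduct_mulVec_pos ?_ fun c hc => ?_)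
  · ext i j
    simp only [modelGram, Matrix.conjTranspose_apply, LinearMap.toMatrix₂_apply, star_trivial]
    exact g.symm y _ _
  · rw [star_trivial]
    refine lt_of_lt_of_eq (g.pos y _ fun h0 => hc ?_) (dotProduct_toMatrix₂_mulVec
      (EuclideanSpace.basisFun (Fin d) ℝ).toBasis (EuclideanSpace.basisFun (Fin d) ℝ).toBasis
      (modelForm g y) c c).symm
    exact (EuclideanSpace.basisFun (Fin d) ℝ).toBasis.equivFun.symm.map_eq_zero_iff.1 h0

/-- The derivative at `u` of the inverse of the preferred chart at `x`, as an endomorphism of the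
model space. -/
noncomputable def chartSymmDeriv (x : M) (u : EuclideanSpace ℝ (Fin d)) :
    EuclideanSpace ℝ (Fin d) →ₗ[ℝ] EuclideanSpace ℝ (Fin d) :=
  (show EuclideanSpace ℝ (Fin d) →L[ℝ] EuclideanSpace ℝ (Fin d) from
    mfderiv (𝓡 d) (𝓡 d) (chartAt (EuclideanSpace ℝ (Fin d)) x).symm u).toLinearMap

/-- The change of basis formula; its factor `det ^ 2` does not depend on the metric and so cancels
in ratios. -/
theorem det_gramMatrix (g : C2Metric d M) (x : M) (u : EuclideanSpace ℝ (Fin d)) :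
    (gramMatrix g x u).det = LinearMap.det (chartSymmDeriv x u) ^ 2 *
      (modelGram g ((chartAt (EuclideanSpace ℝ (Fin d)) x).symm u)).det := by
  have h : gramMatrix g x u = LinearMap.toMatrix₂ (EuclideanSpace.basisFun (Fin d) ℝ).toBasis
      (EuclideanSpace.basisFun (Fin d) ℝ).toBasis
      ((modelForm g ((chartAt (EuclideanSpace ℝ (Fin d)) x).symm u)).compl₁₂
        (chartSymmDeriv x u) (chartSymmDeriv x u)) := by
    ext i j
    rw [LinearMap.toMatrix₂_apply, LinearMap.compl₁₂_apply]
    simp only [OrthonormalBasis.coe_toBasis, EuclideanSpace.basisFun_apply]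
    rfl
  rw [h, LinearMap.toMatrix₂_compl₁₂ (EuclideanSpace.basisFun (Fin d) ℝ).toBasis
    (EuclideanSpace.basisFun (Fin d) ℝ).toBasis, Matrix.det_mul, Matrix.det_mul,
    Matrix.det_transpose, LinearMap.det_toMatrix, modelGram]
  ring

theorem det_gramMatrix_pos (g : C2Metric d M) {x : M} {u : EuclideanSpace ℝ (Fin d)}
    (hu : u ∈ (chartAt (EuclideanSpace ℝ (Fin d)) x).target) : 0 < (gramMatrix g x u).det := by
  rw [det_gramMatrix]
  refine mul_pos (sq_pos_iff.2 ?_) (det_modelGram_pos g _)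
  have : IsManifold (𝓡 d) 1 M := IsManifold.of_le (n := ∞) (by norm_cast)
  have h1 := (mdifferentiable_chart (I := 𝓡 d) x).comp_symm_deriv hu
  let Q : EuclideanSpace ℝ (Fin d) →L[ℝ] EuclideanSpace ℝ (Fin d) :=
    mfderiv (𝓡 d) (𝓡 d) (chartAt (EuclideanSpace ℝ (Fin d)) x)
      ((chartAt (EuclideanSpace ℝ (Fin d)) x).symm u)
  have h2 : Q.toLinearMap ∘ₗ chartSymmDeriv x u = LinearMap.id := by
    ext1 v
    exact congr($h1 v)
  have h3 := congrArg LinearMap.det h2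
  rw [LinearMap.det_comp, LinearMap.det_id] at h3
  exact right_ne_zero_of_mul_eq_one h3

theorem continuousOn_coordVector (x : M) (i : Fin d) :
    ContinuousOn (fun u => (⟨(chartAt (EuclideanSpace ℝ (Fin d)) x).symm u, coordVector x u i⟩ :
      TangentBundle (𝓡 d) M)) (chartAt (EuclideanSpace ℝ (Fin d)) x).target := by
  have : IsManifold (𝓡 d) 1 M := IsManifold.of_le (n := ∞) (by norm_cast)
  have ho := (chartAt (EuclideanSpace ℝ (Fin d)) x).open_target
  have h := (contMDiffOn_chart_symm (I := 𝓡 d) (n := 1) (x := x)).continuousOn_tangentMapWithin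
    le_rfl ho.uniqueMDiffOn
  have hc : Continuous fun u : EuclideanSpace ℝ (Fin d) =>
      (tangentBundleModelSpaceHomeomorph (𝓡 d)).symm (u, EuclideanSpace.single i (1 : ℝ)) :=
    (tangentBundleModelSpaceHomeomorph (𝓡 d)).symm.continuous.comp
      (continuous_id.prodMk continuous_const)
  refine (h.comp (s := (chartAt (EuclideanSpace ℝ (Fin d)) x).target) hc.continuousOn
    fun u hu => hu).congr fun u hu => ?_
  have hm : mfderivWithin (𝓡 d) (𝓡 d) (chartAt (EuclideanSpace ℝ (Fin d)) x).symm
      (chartAt (EuclideanSpace ℝ (Fin d)) x).target u =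
        mfderiv (𝓡 d) (𝓡 d) (chartAt (EuclideanSpace ℝ (Fin d)) x).symm u :=
    mfderivWithin_of_isOpen ho hu
  exact (congrArg (fun L => (⟨(chartAt (EuclideanSpace ℝ (Fin d)) x).symm u,
    L (EuclideanSpace.single i (1 : ℝ) : EuclideanSpace ℝ (Fin d))⟩ : TangentBundle (𝓡 d) M))
      hm).symm

theorem continuousOn_det_gramMatrix (g : C2Metric d M) (x : M) :
    ContinuousOn (fun u => (gramMatrix g x u).det)
      (chartAt (EuclideanSpace ℝ (Fin d)) x).target := by
  let : Bundle.RiemannianBundle (fun x : M => TangentSpace (𝓡 d) x) := ⟨g.toRiemannianMetric⟩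
  have := g.isContinuousRiemannianBundle
  rw [continuousOn_iff_continuous_domRestrict]
  refine Continuous.matrix_det (continuous_matrix fun i j => ?_)
  exact continuousOn_iff_continuous_domRestrict.1
    ((continuousOn_coordVector x i).inner_bundle (continuousOn_coordVector x j))

/-- The density of the volume of `g₁` with respect to the volume of `g₂`. -/
noncomputable def volumeRatio (g₁ g₂ : C2Metric d M) (y : M) : ℝ :=
  Real.sqrt (modelGram g₁ y).det / Real.sqrt (modelGram g₂ y).det

theorem sqrt_det_gramMatrix (g₁ g₂ : C2Metric d M) (x : M) (u : EuclideanSpace ℝ (Fin d)) :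
    Real.sqrt (gramMatrix g₁ x u).det =
      volumeRatio g₁ g₂ ((chartAt (EuclideanSpace ℝ (Fin d)) x).symm u) *
        Real.sqrt (gramMatrix g₂ x u).det := by
  have h := (Real.sqrt_pos.2 (det_modelGram_pos g₂
    ((chartAt (EuclideanSpace ℝ (Fin d)) x).symm u))).ne'
  rw [det_gramMatrix, det_gramMatrix, Real.sqrt_mul (sq_nonneg _), Real.sqrt_mul (sq_nonneg _),
    volumeRatio]
  field_simp

theorem continuous_volumeRatio (g₁ g₂ : C2Metric d M) : Continuous (volumeRatio g₁ g₂) := by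
  refine continuous_iff_continuousAt.2 fun x => ?_
  let e := chartAt (EuclideanSpace ℝ (Fin d)) x
  have h : ContinuousOn (fun u => Real.sqrt (gramMatrix g₁ x u).det /
      Real.sqrt (gramMatrix g₂ x u).det) e.target :=
    (continuousOn_det_gramMatrix g₁ x).sqrt.div (continuousOn_det_gramMatrix g₂ x).sqrt
      fun u hu => (Real.sqrt_pos.2 (det_gramMatrix_pos g₂ hu)).ne'
  have h2 := (h.comp e.continuousOn e.mapsTo).continuousAt (chart_source_mem_nhds _ x)
  refine h2.congr ?_
  filter_upwards [chart_source_mem_nhds (EuclideanSpace ℝ (Fin d)) x] with y hy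
  rw [Function.comp_apply, sqrt_det_gramMatrix g₁ g₂, e.left_inv hy,
    mul_div_cancel_right₀ _ (Real.sqrt_pos.2 (det_gramMatrix_pos g₂ (e.mapsTo hy))).ne']

theorem volumeRatio_self (g : C2Metric d M) (y : M) : volumeRatio g g y = 1 :=
  div_self (Real.sqrt_pos.2 (det_modelGram_pos g y)).ne'

/-! ### The Gaussian kernel -/

section Kernel

/-- The geodesic distance is an extended metric that induces the topology of `M`. -/
theorem exists_emetricSpace_geodesicEDist [T3Space M] (g : C2Metric d M) :
    ∃ m : EMetricSpace M, m.toUniformSpace.toTopologicalSpace = ‹TopologicalSpace M› ∧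
      ∀ x y, m.edist x y = geodesicEDist g x y := by
  let : Bundle.RiemannianBundle (fun x : M => TangentSpace (𝓡 d) x) := ⟨g.toRiemannianMetric⟩
  have := g.isContinuousRiemannianBundle
  have : IsManifold (𝓡 d) 1 M := IsManifold.of_le (n := ∞) (by norm_cast)
  exact ⟨EMetricSpace.ofRiemannianMetric (𝓡 d) M, rfl, fun x y => rfl⟩

theorem gaussianKernel_self (g : C2Metric d M) (t : ℝ) (x : M) : gaussianKernel g t x x = 1 := by
  have h : geodesicEDist g x x = 0 := by
    let : Bundle.RiemannianBundle (fun x : M => TangentSpace (𝓡 d) x) := ⟨g.toRiemannianMetric⟩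
    exact riemannianEDist_self
  simp [gaussianKernel, h]

theorem geodesicEDist_eq_of_gaussianKernel_eq {g₁ g₂ : C2Metric d M} {t : ℝ} (ht : 0 < t) {x y : M}
    (h : gaussianKernel g₁ t x y = gaussianKernel g₂ t x y) :
    geodesicEDist g₁ x y = geodesicEDist g₂ x y := by
  unfold gaussianKernel at h
  split_ifs at h with h₁ h₂ h₂
  · rw [h₁, h₂]
  · exact absurd h (Real.exp_pos _).ne
  · exact absurd h (Real.exp_pos _).ne'
  · have h3 := Real.exp_injective h
    rw [div_left_inj' ht.ne', neg_inj, sq_eq_sq₀ ENNReal.toReal_nonneg ENNReal.toReal_nonneg] at h3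
    exact (ENNReal.toReal_eq_toReal_iff' h₁ h₂).1 h3

theorem gaussianKernel_lt_one [T3Space M] (g : C2Metric d M) {t : ℝ} (ht : 0 < t) {x y : M}
    (hxy : x ≠ y) : gaussianKernel g t x y < 1 := by
  obtain ⟨m, -, hm⟩ := exists_emetricSpace_geodesicEDist g
  unfold gaussianKernel
  split_ifs with h
  · exact one_pos
  · have h0 : geodesicEDist g x y ≠ 0 := fun h0 => hxy (m.eq_of_edist_eq_zero ((hm x y).trans h0))
    have := ENNReal.toReal_pos h0 h
    rw [Real.exp_lt_one_iff]
    exact div_neg_of_neg_of_pos (by simpa using pow_pos this 2) ht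

theorem continuous_gaussianKernel [T3Space M] (g : C2Metric d M) (t : ℝ) (x : M) :
    Continuous (gaussianKernel g t x) := by
  obtain ⟨m, rfl, hm⟩ := exists_emetricSpace_geodesicEDist g
  have hc : Continuous (geodesicEDist g x) := by
    have : Continuous fun y : M => edist x y := by fun_prop
    exact this.congr (hm x)
  refine continuous_iff_continuousAt.2 fun y => ?_
  have hnear : ∀ᶠ z in 𝓝 y, (geodesicEDist g x z = ⊤ ↔ geodesicEDist g x y = ⊤) := by
    filter_upwards [Metric.eball_mem_nhds y one_pos] with z hz
    -- points at finite distance from each other are at finite distance from the same points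
    have hzy : edist z y ≠ ⊤ := (hz.trans ENNReal.one_lt_top).ne
    rw [← hm, ← hm]
    constructor <;> intro h <;> by_contra h'
    · refine ((edist_triangle x y z).trans_lt
        (ENNReal.add_lt_top.2 ⟨lt_top_iff_ne_top.2 h', ?_⟩)).ne h
      rw [edist_comm]
      exact lt_top_iff_ne_top.2 hzy
    · exact ((edist_triangle x z y).trans_lt
        (ENNReal.add_lt_top.2 ⟨lt_top_iff_ne_top.2 h', lt_top_iff_ne_top.2 hzy⟩)).ne h
  by_cases hy : geodesicEDist g x y = ⊤
  · refine (continuousAt_const (y := (0 : ℝ))).congr ?_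
    filter_upwards [hnear] with z hz
    simp [gaussianKernel, hz.2 hy]
  · have h1 : ContinuousAt (fun z => Real.exp (-(geodesicEDist g x z).toReal ^ 2 / t)) y := by
      have := (ENNReal.continuousAt_toReal hy).comp hc.continuousAt
      exact (((this.pow 2).neg).div_const t).rexp
    refine h1.congr ?_
    filter_upwards [hnear] with z hz
    simp [gaussianKernel, mt hz.1 hy]

end Kernel

/-! ### The Riemannian volume -/

section Volume

variable [T2Space M] [MeasurableSpace M] [BorelSpace M]

omit [T2Space M] [MeasurableSpace M] [BorelSpace M] in
theorem aemeasurable_gramDensity (g : C2Metric d M) (x : M) :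
    AEMeasurable (fun u => ENNReal.ofReal (Real.sqrt (gramMatrix g x u).det))
      ((volume : Measure (EuclideanSpace ℝ (Fin d))).restrict
        (chartAt (EuclideanSpace ℝ (Fin d)) x).target) :=
  ((continuousOn_det_gramMatrix g x).sqrt.aemeasurable
    (chartAt (EuclideanSpace ℝ (Fin d)) x).open_target.measurableSet).ennreal_ofReal

omit [IsManifold (𝓡 d) ∞ M] [T2Space M] in
theorem aemeasurable_chartAt_symm (x : M) :
    AEMeasurable (chartAt (EuclideanSpace ℝ (Fin d)) x).symm
      ((volume : Measure (EuclideanSpace ℝ (Fin d))).restrict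
        (chartAt (EuclideanSpace ℝ (Fin d)) x).target) :=
  (chartAt (EuclideanSpace ℝ (Fin d)) x).continuousOn_symm.aemeasurable
    (chartAt (EuclideanSpace ℝ (Fin d)) x).open_target.measurableSet

omit [T2Space M] in
theorem lintegral_chartVolume (g : C2Metric d M) (x : M) {f : M → ℝ≥0∞} (hf : Measurable f) :
    ∫⁻ y, f y ∂(chartVolume g x) =
      ∫⁻ u in (chartAt (EuclideanSpace ℝ (Fin d)) x).target,
        ENNReal.ofReal (Real.sqrt (gramMatrix g x u).det) *
          f ((chartAt (EuclideanSpace ℝ (Fin d)) x).symm u) := by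
  have hs := aemeasurable_chartAt_symm (d := d) x
  rw [chartVolume, lintegral_map' hf.aemeasurable
    (hs.mono_ac (withDensity_absolutelyContinuous _ _))]
  exact lintegral_withDensity_eq_lintegral_mul₀ (aemeasurable_gramDensity g x)
    (hf.comp_aemeasurable hs)

variable [CompactSpace M]

/-- The gluing formula that defines the volume, for arbitrary nonnegative measurable functions. -/
theorem lintegral_riemannianVolume (g : C2Metric d M) {f : M → ℝ≥0∞} (hf : Measurable f) :
    ∫⁻ y, f y ∂(riemannianVolume g) =
      ∑' x : M, ∫⁻ u in (chartAt (EuclideanSpace ℝ (Fin d)) x).target,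
        ENNReal.ofReal (Real.sqrt (gramMatrix g x u).det) *
          (ENNReal.ofReal (chartPartition d M x ((chartAt (EuclideanSpace ℝ (Fin d)) x).symm u)) *
            f ((chartAt (EuclideanSpace ℝ (Fin d)) x).symm u)) := by
  rw [riemannianVolume, lintegral_sum_measure]
  refine tsum_congr fun x => ?_
  have hρ : Measurable fun y => ENNReal.ofReal (chartPartition d M x y) :=
    (chartPartition d M x).continuous.measurable.ennreal_ofReal
  rw [lintegral_withDensity_eq_lintegral_mul _ hρ hf, lintegral_chartVolume g x (hρ.mul hf)]
  rfl

theorem riemannianVolume_eq_withDensity (g₁ g₂ : C2Metric d M) :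
    riemannianVolume g₁ =
      (riemannianVolume g₂).withDensity fun y => ENNReal.ofReal (volumeRatio g₁ g₂ y) := by
  have hR : Measurable fun y => ENNReal.ofReal (volumeRatio g₁ g₂ y) :=
    (continuous_volumeRatio g₁ g₂).measurable.ennreal_ofReal
  refine Measure.ext_of_lintegral _ fun f hf => ?_
  rw [lintegral_withDensity_eq_lintegral_mul _ hR hf, lintegral_riemannianVolume g₁ hf,
    lintegral_riemannianVolume g₂ (hR.mul hf)]
  refine tsum_congr fun x => lintegral_congr fun u => ?_
  rw [sqrt_det_gramMatrix g₁ g₂, mul_comm (volumeRatio g₁ g₂ _),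
    ENNReal.ofReal_mul (Real.sqrt_nonneg _), Pi.mul_apply]
  ring

omit [IsManifold (𝓡 d) ∞ M] [MeasurableSpace M] [BorelSpace M] in
theorem chartPartition_isSubordinate :
    (chartPartition d M).IsSubordinate fun x => (chartAt (EuclideanSpace ℝ (Fin d)) x).source :=
  (exists_chartPartition d M).choose_spec

instance isFiniteMeasure_riemannianVolume (g : C2Metric d M) :
    IsFiniteMeasure (riemannianVolume g) := by
  refine ⟨?_⟩
  rw [← lintegral_one, lintegral_riemannianVolume g measurable_const]
  -- by compactness only finitely many functions of the partition of unity are nonzero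
  have hfin := (chartPartition d M).locallyFinite.finite_nonempty_of_compact
  rw [tsum_eq_sum (s := hfin.toFinset)]
  · refine ENNReal.sum_lt_top.2 fun x _ => ?_
    let e := chartAt (EuclideanSpace ℝ (Fin d)) x
    have hsub : tsupport (chartPartition d M x) ⊆ e.source := chartPartition_isSubordinate x
    have hK : IsCompact (e '' tsupport (chartPartition d M x)) :=
      (isClosed_tsupport _).isCompact.image_of_continuousOn (e.continuousOn.mono hsub)
    have hKT : e '' tsupport (chartPartition d M x) ⊆ e.target :=
      (image_mono hsub).trans e.image_source_eq_target.subset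
    have hint : IntegrableOn (fun u => Real.sqrt (gramMatrix g x u).det)
        (e '' tsupport (chartPartition d M x)) :=
      ((continuousOn_det_gramMatrix g x).sqrt.mono hKT).integrableOn_compact hK
    refine lt_of_le_of_lt ?_ hint.lintegral_lt_top
    rw [← lintegral_indicator e.open_target.measurableSet, ← lintegral_indicator hK.measurableSet]
    refine lintegral_mono fun u => ?_
    by_cases huT : u ∈ e.target
    · rw [indicator_of_mem huT]
      by_cases huK : u ∈ e '' tsupport (chartPartition d M x)
      · rw [indicator_of_mem huK, mul_one]
        refine (mul_le_mul_right (ENNReal.ofReal_le_one.2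
          ((chartPartition d M).le_one x _)) _).trans (mul_one _).le
      · have h0 : chartPartition d M x (e.symm u) = 0 := by
          by_contra h0
          exact huK ⟨e.symm u, subset_tsupport _ h0, e.right_inv huT⟩
        change _ * (ENNReal.ofReal (chartPartition d M x (e.symm u)) * 1) ≤ _
        simp [h0]
    · rw [indicator_of_notMem huT]
      exact zero_le
  · intro x hx
    have h0 : ∀ y, chartPartition d M x y = 0 := by
      intro y
      by_contra h0
      exact hx (hfin.mem_toFinset.2 ⟨y, h0⟩)
    simp [h0]

/-- A nonempty open set meets some `{ρ_x > 0}` in an open set, whose image in the chart at `x` has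
positive Lebesgue measure; the density is positive there. -/
instance isOpenPosMeasure_riemannianVolume (g : C2Metric d M) :
    (riemannianVolume g).IsOpenPosMeasure := by
  refine ⟨fun U hU ⟨y, hy⟩ h0 => ?_⟩
  obtain ⟨x, hx⟩ := (chartPartition d M).exists_pos (mem_univ y)
  let e := chartAt (EuclideanSpace ℝ (Fin d)) x
  have hys : y ∈ e.source := chartPartition_isSubordinate x (subset_tsupport _ hx.ne')
  let W : Set M := U ∩ {z | 0 < chartPartition d M x z}
  have hW : IsOpen W := hU.inter (isOpen_lt continuous_const (chartPartition d M x).continuous)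
  have hV : IsOpen (e.target ∩ e.symm ⁻¹' W) := e.isOpen_inter_preimage_symm hW
  have hne : (e.target ∩ e.symm ⁻¹' W).Nonempty :=
    ⟨e y, e.mapsTo hys, by rw [mem_preimage, e.left_inv hys]; exact ⟨hy, hx⟩⟩
  have hf : Measurable (U.indicator (1 : M → ℝ≥0∞)) := measurable_one.indicator hU.measurableSet
  rw [← lintegral_indicator_one hU.measurableSet, lintegral_riemannianVolume g hf,
    ENNReal.tsum_eq_zero] at h0
  have hs := aemeasurable_chartAt_symm (d := d) x
  have hρ : Measurable fun y => ENNReal.ofReal (chartPartition d M x y) :=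
    (chartPartition d M x).continuous.measurable.ennreal_ofReal
  have hae := (lintegral_eq_zero_iff' ((aemeasurable_gramDensity g x).mul
    ((hρ.comp_aemeasurable hs).mul (hf.comp_aemeasurable hs)))).1 (h0 x)
  rw [Filter.EventuallyEq, ae_restrict_iff' e.open_target.measurableSet] at hae
  refine (hV.measure_pos volume hne).ne' (measure_mono_null (fun u hu => ?_) (ae_iff.1 hae))
  rw [mem_ofPred_eq, Classical.not_imp]
  refine ⟨hu.1, mul_ne_zero ?_ (mul_ne_zero ?_ ?_)⟩
  · simpa using det_gramMatrix_pos g hu.1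
  · simpa using hu.2.2
  · exact (indicator_of_mem hu.2.1 _).trans_ne one_ne_zero

end Volume

/-! ### Determination of the kernel and of the density -/

omit [IsManifold (𝓡 d) ∞ M] in
theorem not_isOpen_singleton_of_one_le (hd : 1 ≤ d) (x : M) : ¬ IsOpen ({x} : Set M) := by
  intro h
  have : Nonempty (Fin d) := ⟨⟨0, hd⟩⟩
  let e := chartAt (EuclideanSpace ℝ (Fin d)) x
  have h2 : IsOpen (e '' {x}) :=
    e.isOpen_image_of_subset_source h (singleton_subset_iff.2 (mem_chart_source _ x))
  rw [image_singleton] at h2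
  exact not_isOpen_singleton _ h2

variable [T2Space M] [CompactSpace M] [MeasurableSpace M] [BorelSpace M]

/-- The operator of `g₁` on functions vanishing at `x`, as an integral against the volume of
another metric `g₂`. -/
theorem intrinsicGraphLaplacian_eq_neg_integral (g₁ g₂ : C2Metric d M) (t : ℝ) (p f : C(M, ℝ))
    {x : M} (hf : f x = 0) :
    intrinsicGraphLaplacian g₁ t p f x = -(1 / t ^ ((d : ℝ) / 2 + 1) *
      ∫ y, gaussianKernel g₁ t x y * p y * volumeRatio g₁ g₂ y * f y ∂(riemannianVolume g₂)) := by
  have hR : Measurable fun y => ENNReal.ofReal (volumeRatio g₁ g₂ y) :=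
    (continuous_volumeRatio g₁ g₂).measurable.ennreal_ofReal
  rw [intrinsicGraphLaplacian, riemannianVolume_eq_withDensity g₁ g₂,
    integral_withDensity_eq_integral_toReal_smul hR (ae_of_all _ fun _ => ENNReal.ofReal_lt_top),
    ← mul_neg, ← integral_neg]
  congr 1
  refine integral_congr_ae (ae_of_all _ fun y => ?_)
  have h0 : 0 ≤ volumeRatio g₁ g₂ y := div_nonneg (Real.sqrt_nonneg _) (Real.sqrt_nonneg _)
  simp only [hf, ENNReal.toReal_ofReal h0, smul_eq_mul]
  ring

/-- The operator determines the density of `k(x, ·) p μ_g` with respect to a fixed volume measure.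
A continuous density is determined off `x` by test functions vanishing at `x`, and `x` is not
isolated. -/
theorem gaussianKernel_mul_density_eq (hd : 1 ≤ d) {t : ℝ} (ht : 0 < t) {g₁ g₂ : C2Metric d M}
    {p₁ p₂ : C(M, ℝ)} (hL : intrinsicGraphLaplacian g₁ t p₁ = intrinsicGraphLaplacian g₂ t p₂)
    (x y : M) :
    gaussianKernel g₁ t x y * p₁ y * volumeRatio g₁ g₂ y = gaussianKernel g₂ t x y * p₂ y := by
  have hk₁ := continuous_gaussianKernel g₁ t x
  have hk₂ := continuous_gaussianKernel g₂ t x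
  have hR := continuous_volumeRatio g₁ g₂
  let F : M → ℝ := fun y =>
    gaussianKernel g₁ t x y * p₁ y * volumeRatio g₁ g₂ y - gaussianKernel g₂ t x y * p₂ y
  have hF : Continuous F := by fun_prop
  -- the factor `1 - k₁(x, ·)` is continuous and nonnegative, and vanishes only at `x`
  let f : C(M, ℝ) := ⟨fun y => F y * (1 - gaussianKernel g₁ t x y), by fun_prop⟩
  have hfx : f x = 0 := by simp [f, gaussianKernel_self]
  have hI : ∀ h : M → ℝ, Continuous h → Integrable h (riemannianVolume g₂) := fun h hh =>
    hh.integrable_of_hasCompactSupport (HasCompactSupport.of_compactSpace h)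
  have h1 := congrFun (congrFun hL f) x
  rw [intrinsicGraphLaplacian_eq_neg_integral g₁ g₂ t p₁ f hfx,
    intrinsicGraphLaplacian_eq_neg_integral g₂ g₂ t p₂ f hfx, neg_inj,
    mul_right_inj' (one_div_pos.2 (Real.rpow_pos_of_pos ht _)).ne', ← sub_eq_zero] at h1
  simp only [volumeRatio_self, mul_one] at h1
  rw [← integral_sub (hI _ (by fun_prop)) (hI _ (by fun_prop))] at h1
  have hk : ∀ y, gaussianKernel g₁ t x y ≤ 1 := fun y => by
    rcases eq_or_ne x y with rfl | hxy
    · exact (gaussianKernel_self g₁ t x).le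
    · exact (gaussianKernel_lt_one g₁ ht hxy).le
  have h2 : ∫ y, F y ^ 2 * (1 - gaussianKernel g₁ t x y) ∂(riemannianVolume g₂) = 0 := by
    rw [← h1]
    refine integral_congr_ae (ae_of_all _ fun y => ?_)
    simp only [f, F, ContinuousMap.coe_mk]
    ring
  have hc : Continuous fun y => F y ^ 2 * (1 - gaussianKernel g₁ t x y) := by fun_prop
  rw [integral_eq_zero_iff_of_nonneg
    (fun y => mul_nonneg (sq_nonneg _) (sub_nonneg.2 (hk y))) (hI _ hc)] at h2
  have h3 := (Continuous.ae_eq_iff_eq _ hc continuous_zero).1 h2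
  have hoff : ∀ y, y ≠ x → F y = 0 := by
    intro y hy
    have := congrFun h3 y
    simpa [(sub_pos.2 (gaussianKernel_lt_one g₁ ht hy.symm)).ne'] using this
  have hF0 : {y | F y ≠ 0} = ∅ := by
    have hsub : {y | F y ≠ 0} ⊆ {x} := fun y hy => by_contra fun hyx => hy (hoff y hyx)
    refine (subset_singleton_iff_eq.1 hsub).resolve_right fun heq => ?_
    exact not_isOpen_singleton_of_one_le hd x (heq ▸ isOpen_ne_fun hF continuous_const)
  by_contra hne
  exact (hF0 ▸ (show y ∈ {y | F y ≠ 0} from sub_ne_zero.2 hne) : y ∈ (∅ : Set M))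

end GraphLaplacian

theorem mainTheorem1 {d : ℕ} (hd : 1 ≤ d) {M : Type*} [TopologicalSpace M] [T2Space M]
    [CompactSpace M] [ChartedSpace (EuclideanSpace ℝ (Fin d)) M] [IsManifold (𝓡 d) ∞ M]
    [MeasurableSpace M] [BorelSpace M] (t : ℝ) (ht : 0 < t)
    (g₁ g₂ : GraphLaplacian.C2Metric d M) (p₁ p₂ : C(M, ℝ))
    (hp₁ : ∀ x, 0 < p₁ x) (hp₂ : ∀ x, 0 < p₂ x)
    (hL : GraphLaplacian.intrinsicGraphLaplacian g₁ t p₁ =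
      GraphLaplacian.intrinsicGraphLaplacian g₂ t p₂) :
    g₁ = g₂ ∧ p₁ = p₂ := by
  have hF := GraphLaplacian.gaussianKernel_mul_density_eq hd ht hL
  have hp : ∀ y, p₁ y * GraphLaplacian.volumeRatio g₁ g₂ y = p₂ y := fun y => by
    simpa [GraphLaplacian.gaussianKernel_self] using hF y y
  have hg : g₁ = g₂ := by
    refine GraphLaplacian.C2Metric.eq_of_geodesicEDist_eq fun x y =>
      GraphLaplacian.geodesicEDist_eq_of_gaussianKernel_eq ht ?_
    have := hF x y
    rw [mul_assoc, hp y] at this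
    exact mul_right_cancel₀ (hp₂ y).ne' this
  subst hg
  refine ⟨rfl, ContinuousMap.ext fun y => ?_⟩
  simpa [GraphLaplacian.volumeRatio_self] using hp y
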